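/- Let $(G,X)$ and $(M,X_M)$ be Shimura data in the sense of Deligne: $G$ is a connected reductive algebraic group over $\mathbb{Q}$, $X$ is a $G(\mathbb{R})$-conjugacy class of homomorphisms $h:\mathbb{S}=\mathrm{Res}_{\mathbb{C}/\mathbb{R}}\mathbb{G}_m\to G_{\mathbb{R}}$ such that for $h\in X$ the Hodge structure on $\mathrm{Lie}(G)$ given by $\mathrm{Ad}\circ h$ is of type $\{(-1,1),(0,0),(1,-1)\}$, conjugation by $h(i)$ is a Cartan involution of $G^{ad}_{\mathbb{R}}$, and $G^{ad}$ has no nontrivial direct factor over $\mathbb{Q}$ on which the projection of $h$ is trivial; likewise for $(M,X_M)$. Here $H^{ad}:=H/Z(H)$ denotes the quotient of an algebraic group $H$ by its centre, and for $h:\mathbb{S}\to H_{\mathbb{R}}$ we write $h^{ad}:\mathbb{S}\to H^{ad}_{\mathbb{R}}$ for the composite of $h$ with the quotient map. For $x'\in X$ let $(M_{x'},X_{x'})$ be the Mumford–Tate datum of $x'$, that is, the smallest Shimura subdatum of $(G,X)$ with $x'\in X_{x'}$. Let $x\in X_M$ be Hodge generic, that is, the Mumford–Tate group of $x$ contains the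 Mumford–Tate group of every point of $X_M$. Then the hybrid Hecke orbit \[ \Sigma_X(M,X_M,x)=\{x'\in X : \text{there is a morphism } \phi:M^{ad}\to M_{x'}^{ad} \text{ of algebraic groups over } \mathbb{Q} \text{ with } \phi\circ x^{ad}=x'^{ad}\} \] is countable. -/

import Mathlib

open scoped TensorProduct

universe u v

namespace HybridHecke

/-! ### The Deligne torus -/

open MvPolynomial in
/-- The norm form `a² + b²`. -/
noncomputable abbrev normForm : MvPolynomial (Fin 2) ℝ := X 0 ^ 2 + X 1 ^ 2

/-- The coordinate ring `ℝ[a, b, (a² + b²)⁻¹]` of the Deligne torus `𝕊 = Res_{ℂ/ℝ} 𝔾ₘ`;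
the point `(a, b)` stands for `a + b i`. -/
abbrev DeligneRing : Type := Localization.Away normForm

namespace DeligneRing
open MvPolynomial
/-- The coordinate function `a` (real part). -/
noncomputable def a : DeligneRing := algebraMap (MvPolynomial (Fin 2) ℝ) DeligneRing (X 0)
/-- The coordinate function `b` (imaginary part). -/
noncomputable def b : DeligneRing := algebraMap (MvPolynomial (Fin 2) ℝ) DeligneRing (X 1)

lemma isUnit_norm : IsUnit (a ^ 2 + b ^ 2) := by
  have h := IsLocalization.Away.algebraMap_isUnit (S := DeligneRing) normForm
  simpa [a, b] using h

variable {B : Type*} [CommRing B] [Algebra ℝ B]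

/-- The algebra map out of `DeligneRing` with `a ↦ u` and `b ↦ v`. -/
noncomputable def lift (u v : B) (h : IsUnit (u ^ 2 + v ^ 2)) : DeligneRing →ₐ[ℝ] B :=
  IsLocalization.liftAlgHom (M := Submonoid.powers normForm)
    (f := MvPolynomial.aeval (fun i : Fin 2 => if i = 0 then u else v)) (by
      rintro ⟨_, n, rfl⟩
      simpa using h.pow n)

@[simp] lemma lift_a (u v : B) (h : IsUnit (u ^ 2 + v ^ 2)) : lift u v h a = u := by
  simp [lift, a]

@[simp] lemma lift_b (u v : B) (h : IsUnit (u ^ 2 + v ^ 2)) : lift u v h b = v := by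
  simp [lift, b]

lemma algHom_ext {f g : DeligneRing →ₐ[ℝ] B} (ha : f a = g a) (hb : f b = g b) : f = g := by
  apply IsLocalization.algHom_ext (Submonoid.powers normForm)
  apply MvPolynomial.algHom_ext
  intro i
  fin_cases i
  · exact ha
  · exact hb

/-- `(a + b i)(a' + b' i) = (a a' - b b') + (a b' + b a') i`. -/
noncomputable def comulHom : DeligneRing →ₐ[ℝ] DeligneRing ⊗[ℝ] DeligneRing :=
  lift (a ⊗ₜ a - b ⊗ₜ b) (a ⊗ₜ b + b ⊗ₜ a) (by
    have h : (a ⊗ₜ[ℝ] a - b ⊗ₜ[ℝ] b) ^ 2 + (a ⊗ₜ[ℝ] b + b ⊗ₜ[ℝ] a) ^ 2 =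
        ((a ^ 2 + b ^ 2) ⊗ₜ[ℝ] 1) * (1 ⊗ₜ[ℝ] (a ^ 2 + b ^ 2)) := by
      simp only [sq, sub_mul, mul_sub, add_mul, mul_add, Algebra.TensorProduct.tmul_mul_tmul,
        TensorProduct.add_tmul, TensorProduct.tmul_add, one_mul, mul_one, mul_comm b a]
      abel
    rw [h]
    exact (isUnit_norm.map (Algebra.TensorProduct.includeLeft (R := ℝ) (S := ℝ)
      (A := DeligneRing) (B := DeligneRing))).mul
      (isUnit_norm.map (Algebra.TensorProduct.includeRight (R := ℝ)
      (A := DeligneRing) (B := DeligneRing))))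

/-- Evaluation at `1`. -/
noncomputable def counitHom : DeligneRing →ₐ[ℝ] ℝ := lift 1 0 (by simp)

/-- `(a² + b²)⁻¹`. -/
noncomputable def normInv : DeligneRing := ((isUnit_norm.unit⁻¹ : DeligneRingˣ) : DeligneRing)

lemma norm_mul_normInv : (a ^ 2 + b ^ 2) * normInv = 1 := isUnit_norm.mul_val_inv

/-- `(a + b i)⁻¹ = (a - b i) / (a² + b²)`. -/
noncomputable def antipodeHom : DeligneRing →ₐ[ℝ] DeligneRing :=
  lift (a * normInv) (-(b * normInv)) (by
    apply IsUnit.of_mul_eq_one (a ^ 2 + b ^ 2)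
    linear_combination (1 + (a ^ 2 + b ^ 2) * normInv) * norm_mul_normInv)

noncomputable instance : Bialgebra ℝ DeligneRing :=
  Bialgebra.ofAlgHom comulHom counitHom
    (by
      apply algHom_ext (B := DeligneRing ⊗[ℝ] (DeligneRing ⊗[ℝ] DeligneRing)) <;>
      simp [comulHom, TensorProduct.sub_tmul, TensorProduct.add_tmul, TensorProduct.tmul_sub,
        TensorProduct.tmul_add] <;> abel)
    (by apply algHom_ext <;> simp [comulHom, counitHom])
    (by apply algHom_ext <;> simp [comulHom, counitHom])

noncomputable instance : HopfAlgebra ℝ DeligneRing :=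
  HopfAlgebra.ofAlgHom antipodeHom
    (by
      apply algHom_ext
      · change Algebra.TensorProduct.lift _ _ (fun _ _ => Commute.all _ _) (comulHom a) = algebraMap ℝ DeligneRing (counitHom a)
        simp [comulHom, counitHom, antipodeHom]
        linear_combination norm_mul_normInv
      · change Algebra.TensorProduct.lift _ _ (fun _ _ => Commute.all _ _) (comulHom b) = algebraMap ℝ DeligneRing (counitHom b)
        simp [comulHom, counitHom, antipodeHom]
        ring)
    (by
      apply algHom_ext
      · change Algebra.TensorProduct.lift _ _ (fun _ _ => Commute.all _ _) (comulHom a) = algebraMap ℝ DeligneRing (counitHom a)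
        simp [comulHom, counitHom, antipodeHom]
        linear_combination norm_mul_normInv
      · change Algebra.TensorProduct.lift _ _ (fun _ _ => Commute.all _ _) (comulHom b) = algebraMap ℝ DeligneRing (counitHom b)
        simp [comulHom, counitHom, antipodeHom]
        ring)

/-- Evaluation of functions on the Deligne torus at `z ∈ 𝕊(ℝ) = ℂˣ`. -/
noncomputable def evalAt (z : ℂˣ) : DeligneRing →ₐ[ℝ] ℝ :=
  lift (z : ℂ).re (z : ℂ).im (by
    have h : Complex.normSq (z : ℂ) ≠ 0 := Complex.normSq_eq_zero.not.mpr z.ne_zero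
    rw [Complex.normSq_apply] at h
    simpa [sq] using h)

end DeligneRing

/-! ### Affine algebraic groups, as commutative Hopf algebras of finite type -/

open WithConv

/-- The points of an affine group scheme form a group under convolution. -/
noncomputable instance convPointsGroup {k A R : Type*} [CommRing k] [CommRing A]
    [HopfAlgebra k A] [CommRing R] [Algebra k R] : Group (WithConv (A →ₐ[k] R)) where
  inv f := toConv (f.ofConv.comp (HopfAlgebra.antipodeAlgHom k A))
  inv_mul_cancel f := by
    apply WithConv.ofConv_injective
    have h := AlgHom.comp_convMul_distrib (B := R) f.ofConv
      (toConv (HopfAlgebra.antipodeAlgHom k A)) (toConv (AlgHom.id k A))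
    rw [AlgHom.antipode_id_cancel] at h
    refine h.symm.trans ?_
    ext; simp [AlgHom.convOne_def]

/-- An affine algebraic group over a field `k`, given by its coordinate ring. -/
structure AlgGrp (k : Type) [Field k] where
  /-- The coordinate ring. -/
  coord : Type u
  [commRing : CommRing coord]
  [hopfAlgebra : HopfAlgebra k coord]
  [finiteType : Algebra.FiniteType k coord]

attribute [instance] AlgGrp.commRing AlgGrp.hopfAlgebra AlgGrp.finiteType

namespace AlgGrp

variable {k : Type} [Field k]

/-- The group `G(R)`. -/
abbrev Points (G : AlgGrp.{u} k) (R : Type*) [CommRing R] [Algebra k R] :=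
  WithConv (G.coord →ₐ[k] R)

/-- The map `G(R) → G(R')` induced by `R → R'`. -/
def Points.map {G : AlgGrp.{u} k} {R R' : Type*} [CommRing R] [Algebra k R] [CommRing R']
    [Algebra k R'] (f : R →ₐ[k] R') (g : G.Points R) : G.Points R' :=
  toConv (f.comp g.ofConv)

/-- Morphisms of algebraic groups over `k`, given by their comorphisms. -/
abbrev Hom (G : AlgGrp.{u} k) (H : AlgGrp.{v} k) := H.coord →ₐc[k] G.coord

/-- The composite `ψ ∘ φ` of morphisms of algebraic groups. -/
def Hom.andThen {G : AlgGrp.{u} k} {H : AlgGrp.{v} k} {K : AlgGrp k}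
    (φ : Hom G H) (ψ : Hom H K) : Hom G K :=
  BialgHom.comp φ ψ

/-- The map `G(R) → H(R)` induced by `φ : G → H`. -/
def Hom.onPoints {G : AlgGrp.{u} k} {H : AlgGrp.{v} k} (φ : Hom G H) {R : Type*} [CommRing R]
    [Algebra k R] (g : G.Points R) : H.Points R :=
  toConv (g.ofConv.comp (φ : H.coord →ₐ[k] G.coord))

/-- A morphism of algebraic groups is trivial if it factors through the trivial group. -/
def Hom.IsTrivial {G : AlgGrp.{u} k} {H : AlgGrp.{v} k} (φ : Hom G H) : Prop :=
  ∀ f : H.coord, φ f = algebraMap k G.coord (Coalgebra.counit f)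

/-- The trivial algebraic group: its coordinate ring is `k`. -/
def IsTrivial (G : AlgGrp.{u} k) : Prop := Function.Surjective (algebraMap k G.coord)

/-- Closed immersions of algebraic groups, that is, inclusions of closed subgroups. -/
def Hom.IsClosedImmersion {G : AlgGrp.{u} k} {H : AlgGrp.{v} k} (φ : Hom G H) : Prop :=
  Function.Surjective φ

/-- Quotient maps of algebraic groups: faithfully flat morphisms. -/
def Hom.IsQuotientMap {G : AlgGrp.{u} k} {H : AlgGrp.{v} k} (φ : Hom G H) : Prop :=
  ((φ : H.coord →ₐ[k] G.coord) : H.coord →+* G.coord).FaithfullyFlat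

/-- Extension of scalars `G_K`. -/
noncomputable def baseChange (G : AlgGrp.{u} k) (K : Type) [Field K] [Algebra k K] :
    AlgGrp.{u} K where
  coord := K ⊗[k] G.coord

/-- Extension of scalars of a morphism. -/
noncomputable def Hom.baseChange {G : AlgGrp.{u} k} {H : AlgGrp.{v} k} (φ : Hom G H) (K : Type)
    [Field K] [Algebra k K] : Hom (G.baseChange K) (H.baseChange K) :=
  Bialgebra.TensorProduct.map (BialgHom.id K K) φ

/-! ### Centre and adjoint group -/

/-- The points `Z(G)(R)` of the scheme-theoretic centre: those `z ∈ G(R)` that commute with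
`G(R')` for every `R`-algebra `R'`. -/
def IsCentral (G : AlgGrp.{u} k) {R : Type u} [CommRing R] [Algebra k R] (z : G.Points R) :
    Prop :=
  ∀ (R' : Type u) [CommRing R'] [Algebra k R'] (f : R →ₐ[k] R') (g : G.Points R'),
    z.map f * g = g * z.map f

/-- The adjoint group `G^ad = G / Z(G)`: an algebraic group with a quotient map from `G` whose
kernel is the centre of `G`. Such a quotient is unique up to unique isomorphism. -/
structure AdjointQuotient (G : AlgGrp.{u} k) where
  /-- The group `G^ad`. -/
  grp : AlgGrp.{u} k
  /-- The quotient map `G → G^ad`. -/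
  proj : Hom G grp
  isQuotientMap : proj.IsQuotientMap
  ker_eq_centre : ∀ (R : Type u) [CommRing R] [Algebra k R] (g : G.Points R),
    proj.onPoints g = 1 ↔ G.IsCentral g

/-! ### Reductive groups -/

/-- Linear representations of `G` on `V`, that is, `O(G)`-comodule structures on `V`. -/
structure IsRepresentation (G : AlgGrp.{u} k) {V : Type} [AddCommGroup V] [Module k V]
    (ρ : V →ₗ[k] V ⊗[k] G.coord) : Prop where
  coassoc : (TensorProduct.assoc k V G.coord G.coord).toLinearMap ∘ₗ
    ρ.rTensor G.coord ∘ₗ ρ = Coalgebra.comul.lTensor V ∘ₗ ρ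
  counit : (TensorProduct.rid k V).toLinearMap ∘ₗ Coalgebra.counit.lTensor V ∘ₗ ρ = LinearMap.id

/-- `G` is unipotent if every nonzero finite-dimensional representation has a nonzero fixed
vector. -/
def IsUnipotent (G : AlgGrp.{u} k) : Prop :=
  ∀ (V : Type) [AddCommGroup V] [Module k V] [Module.Finite k V] [Nontrivial V]
    (ρ : V →ₗ[k] V ⊗[k] G.coord), G.IsRepresentation ρ → ∃ v : V, v ≠ 0 ∧ ρ v = v ⊗ₜ[k] 1

/-- `ι : N → G` has normal image. -/
def Hom.IsNormal {N G : AlgGrp.{u} k} (ι : Hom N G) : Prop :=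
  ∀ (R : Type u) [CommRing R] [Algebra k R] (n : N.Points R) (g : G.Points R),
    ∃ n' : N.Points R, ι.onPoints n' = g * ι.onPoints n * g⁻¹

/-- Connected algebraic groups. -/
def IsConnected (G : AlgGrp.{u} k) : Prop := ConnectedSpace (PrimeSpectrum G.coord)

/-- Connected reductive groups: `G` is connected and smooth (that is, geometrically reduced), and
over an algebraic closure its only smooth connected unipotent normal subgroup is trivial. -/
structure IsReductive (G : AlgGrp.{u} k) : Prop where
  connected : G.IsConnected
  smooth : IsReduced (G.baseChange (AlgebraicClosure k)).coord
  unipotentRadical : ∀ (N : AlgGrp.{u} (AlgebraicClosure k))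
    (ι : Hom N (G.baseChange (AlgebraicClosure k))), ι.IsClosedImmersion → ι.IsNormal →
    IsReduced N.coord → N.IsConnected → N.IsUnipotent → N.IsTrivial

/-! ### Lie algebra and adjoint action -/

/-- The elements of `Lie(G) ⊗ R`, as point derivations `O(G) → R` at the identity. -/
def IsTangent (G : AlgGrp.{u} k) {R : Type*} [CommRing R] [Algebra k R]
    (D : G.coord →ₗ[k] R) : Prop :=
  ∀ f g : G.coord, D (f * g) =
    (Coalgebra.counit f : k) • D g + (Coalgebra.counit g : k) • D f

/-- The adjoint action `Ad(g) D = g D g⁻¹` of `G(R)` on `Lie(G) ⊗ R`, with the products taken in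
the convolution algebra of linear maps `O(G) → R`. -/
noncomputable def Ad (G : AlgGrp.{u} k) {R : Type*} [CommRing R] [Algebra k R]
    (g : G.Points R) (D : G.coord →ₗ[k] R) : G.coord →ₗ[k] R :=
  (toConv g.ofConv.toLinearMap * toConv D * toConv (g⁻¹).ofConv.toLinearMap).ofConv

/-! ### Cartan involutions -/

/-- Conjugation by `c ∈ G(ℝ)` is a Cartan involution of the real algebraic group `G`: it is an
involution, and the real form `{g ∈ G(ℂ) : c ḡ c⁻¹ = g}` is compact. The topology of `G(ℂ)` is
that of pointwise convergence of maps `O(G) → ℂ`. -/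
def IsCartanInvolution (G : AlgGrp.{u} ℝ) (c : G.Points ℝ) : Prop :=
  (∀ g : G.Points ℂ, let c' := c.map (Algebra.ofId ℝ ℂ)
    c' * (c' * g * c'⁻¹) * c'⁻¹ = g) ∧
  IsCompact ((fun (g : G.Points ℂ) (f : G.coord) => g.ofConv f) '' {g : G.Points ℂ |
    c.map (Algebra.ofId ℝ ℂ) * g.map (Complex.conjAe : ℂ →ₐ[ℝ] ℂ) *
      (c.map (Algebra.ofId ℝ ℂ))⁻¹ = g})

end AlgGrp

/-! ### Shimura data -/

open AlgGrp

/-- The Deligne torus `𝕊 = Res_{ℂ/ℝ} 𝔾ₘ`. -/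
noncomputable def deligneTorus : AlgGrp.{0} ℝ where
  coord := DeligneRing

/-- Homomorphisms `h : 𝕊 → G_ℝ` of real algebraic groups. -/
abbrev DeligneHom (G : AlgGrp.{u} ℚ) := Hom deligneTorus (G.baseChange ℝ)

namespace DeligneHom

variable {G : AlgGrp.{u} ℚ}

/-- The point `h(z) ∈ G(ℝ)`, for `z ∈ 𝕊(ℝ) = ℂˣ`. -/
noncomputable def eval (h : DeligneHom G) (z : ℂˣ) : (G.baseChange ℝ).Points ℝ :=
  Hom.onPoints h (G := deligneTorus) (toConv (DeligneRing.evalAt z))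

/-- The composite `φ ∘ h : 𝕊 → H_ℝ`, for `φ : G → H` defined over `ℚ`. -/
noncomputable def push {H : AlgGrp.{v} ℚ} (h : DeligneHom G) (φ : Hom G H) : DeligneHom H :=
  Hom.andThen h (φ.baseChange ℝ)

/-- `h' = g h g⁻¹`, for `g ∈ G(ℝ)`. Here `h` and `h'` are read as points of `G_ℝ` with values in
`O(𝕊)`. -/
def IsConjBy (g : (G.baseChange ℝ).Points ℝ) (h h' : DeligneHom G) : Prop :=
  (toConv (h' : (G.baseChange ℝ).coord →ₐ[ℝ] deligneTorus.coord) :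
      (G.baseChange ℝ).Points deligneTorus.coord) =
    g.map (Algebra.ofId ℝ deligneTorus.coord) *
      toConv (h : (G.baseChange ℝ).coord →ₐ[ℝ] deligneTorus.coord) *
      (g.map (Algebra.ofId ℝ deligneTorus.coord))⁻¹

/-- The `G(ℝ)`-conjugacy class of `h`. -/
def conjClass (h : DeligneHom G) : Set (DeligneHom G) := {h' | ∃ g, IsConjBy g h h'}

/-- The Hodge structure on `Lie(G)` defined by `Ad ∘ h` is of type `{(-1,1), (0,0), (1,-1)}`:
`Lie(G) ⊗ ℂ` is the sum of the subspaces where `z ∈ 𝕊(ℝ) = ℂˣ` acts by `z / z̄`, `1`, `z̄ / z`. -/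
def IsHodgeTypeAdjoint (h : DeligneHom G) : Prop :=
  ∀ D : (G.baseChange ℝ).coord →ₗ[ℝ] ℂ, (G.baseChange ℝ).IsTangent D →
    ∃ D₁ D₂ D₃ : (G.baseChange ℝ).coord →ₗ[ℝ] ℂ,
      (G.baseChange ℝ).IsTangent D₁ ∧ (G.baseChange ℝ).IsTangent D₂ ∧
      (G.baseChange ℝ).IsTangent D₃ ∧ D = D₁ + D₂ + D₃ ∧
      ∀ z : ℂˣ, let g := (h.eval z).map (Algebra.ofId ℝ ℂ)
        (G.baseChange ℝ).Ad g D₁ = ((z : ℂ) / star (z : ℂ)) • D₁ ∧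
        (G.baseChange ℝ).Ad g D₂ = D₂ ∧
        (G.baseChange ℝ).Ad g D₃ = (star (z : ℂ) / (z : ℂ)) • D₃

/-- The projection of `h` to every nontrivial direct factor `F` of `Q = F × F'` over `ℚ` is
nontrivial. -/
def NontrivialOnFactors {Q : AlgGrp.{u} ℚ} (h : DeligneHom Q) : Prop :=
  ∀ (F F' : AlgGrp.{u} ℚ) (q : Hom Q F) (q' : Hom Q F'),
    Function.Bijective (Algebra.TensorProduct.productMap
      (q : F.coord →ₐ[ℚ] Q.coord) (q' : F'.coord →ₐ[ℚ] Q.coord)) →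
    (h.push q).IsTrivial → F.IsTrivial

end DeligneHom

/-- Shimura data `(G, X)` in the sense of Deligne. -/
structure ShimuraDatum where
  /-- The group `G`. -/
  G : AlgGrp.{u} ℚ
  /-- The `G(ℝ)`-conjugacy class `X` of homomorphisms `𝕊 → G_ℝ`. -/
  X : Set (DeligneHom G)
  reductive : G.IsReductive
  isConjClass : ∃ h : DeligneHom G, X = h.conjClass
  hodgeType : ∀ h ∈ X, h.IsHodgeTypeAdjoint
  cartan : ∀ h ∈ X, ∃ P : AdjointQuotient G,
    (P.grp.baseChange ℝ).IsCartanInvolution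
      (DeligneHom.eval (h.push P.proj) (Units.mk0 Complex.I Complex.I_ne_zero))
  noTrivialFactor : ∀ h ∈ X, ∃ P : AdjointQuotient G, (h.push P.proj).NontrivialOnFactors

/-- `ι` makes `(H, X_H)` a Shimura subdatum of `(G, X)`. -/
structure IsSubdatum (H D : ShimuraDatum.{u}) (ι : Hom H.G D.G) : Prop where
  isClosedImmersion : ι.IsClosedImmersion
  mapsTo : ∀ y ∈ H.X, DeligneHom.push y ι ∈ D.X

/-- The Mumford-Tate datum of `x`: the smallest Shimura subdatum `(M_x, X_x)` of `(G, X)` such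
that `x ∈ X_x`. -/
structure MumfordTateDatum (D : ShimuraDatum.{u}) (x : DeligneHom D.G) where
  /-- The datum `(M_x, X_x)`. -/
  datum : ShimuraDatum.{u}
  /-- The inclusion `M_x → G`. -/
  incl : Hom datum.G D.G
  isSubdatum : IsSubdatum datum D incl
  /-- The point `x`, as an element of `X_x`. -/
  point : DeligneHom datum.G
  point_mem : point ∈ datum.X
  push_point : point.push incl = x
  smallest : ∀ (H : ShimuraDatum.{u}) (ι : Hom H.G D.G), IsSubdatum H D ι →
    (∃ y ∈ H.X, DeligneHom.push y ι = x) →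
    ∃ j : Hom datum.G H.G, IsSubdatum datum H j ∧ Hom.andThen j ι = incl

/-- `x ∈ X` is Hodge generic: its Mumford-Tate group contains the Mumford-Tate group of every
point of `X`; that is, every element of `X` factors through `H_ℝ`, for every Shimura subdatum
`(H, X_H)` with `x ∈ X_H`. -/
def IsHodgeGeneric (D : ShimuraDatum.{u}) (x : DeligneHom D.G) : Prop :=
  ∀ (H : ShimuraDatum.{u}) (ι : Hom H.G D.G), IsSubdatum H D ι →
    (∃ y ∈ H.X, DeligneHom.push y ι = x) →
    ∀ x₁ ∈ D.X, ∃ y₁ : DeligneHom H.G, y₁.push ι = x₁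

/-- The hybrid Hecke orbit `Σ_X(M, X_M, x)`: the points `x' ∈ X` for which there is a morphism
`φ : M^ad → M_{x'}^ad` over `ℚ` with `φ ∘ x^ad = x'^ad`. -/
def hybridHeckeOrbit (D : ShimuraDatum.{u}) (M : ShimuraDatum.{v}) (x : DeligneHom M.G) :
    Set (DeligneHom D.G) :=
  {x' | x' ∈ D.X ∧ ∃ (T : MumfordTateDatum D x') (P : AdjointQuotient M.G)
    (P' : AdjointQuotient T.datum.G) (φ : Hom P.grp P'.grp),
      DeligneHom.push (DeligneHom.push x P.proj) φ = DeligneHom.push T.point P'.proj}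

end HybridHecke

/-!
The morphisms `φ` are only used through finitely many values. A point `x'` of the orbit lies in one
of countably many strata, recorded by the ideal of its Mumford-Tate group `H` and by finitely many
pairs of functions `(s, t)` such that the functions `s` generate the coordinate ring of `H^ad` and
`s ∘ x' = t ∘ x`. Two points of one stratum factor through the same `H` and agree in `H^ad`, so they
differ by a central point of `H`. As `𝕊` is commutative, they therefore commute with each other.

A family of pairwise commuting homomorphisms `h : 𝕊 → G_ℝ` is countable, as the weights of a torus
are discrete. The coefficients of `h^*(f)` in the characters `z ^ m * z̄ ^ n` are values at `f` of
commuting idempotents in the convolution algebra of functionals on `O(G)`. These values are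
controlled by the pairing `e, e' ↦ (e * e')(f)`, which has finite rank because the comultiplication
of `f` is a finite sum of tensors, and it has only finitely many values on pairwise commuting
idempotents. So `h^*(f)` takes countably many values for each of finitely many generators `f` of
`O(G)`.
-/

namespace HybridHecke

open WithConv AlgGrp

section Countability

lemma countable_of_finiteType (R A : Type*) [CommRing R] [CommRing A] [Algebra R A] [Countable R]
    [Algebra.FiniteType R A] : Countable A := by
  obtain ⟨n, f, hf⟩ := Algebra.FiniteType.iff_quotient_mvPolynomial''.mp ‹Algebra.FiniteType R A›
  have : Countable (MvPolynomial (Fin n) R) := AddMonoidAlgebra.coeff_injective.countable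
  exact hf.countable

lemma countable_submodule_of_isNoetherian (R V : Type*) [Semiring R] [AddCommMonoid V] [Module R V]
    [IsNoetherian R V] [Countable V] : Countable (Submodule R V) :=
  have span_surjective : Function.Surjective fun s : Finset V => Submodule.span R (s : Set V) :=
    IsNoetherian.noetherian
  span_surjective.countable

lemma countable_setOf_finsupp_forall_mem {ι β : Type*} [Countable ι] [Zero β] {F : Set β}
    (hF : F.Countable) : {φ : ι →₀ β | ∀ i, φ i ∈ F}.Countable := by
  have : Countable ↥(insert 0 F) := (hF.insert 0).to_subtype
  let _ : Zero ↥(insert 0 F) := ⟨0, Set.mem_insert 0 F⟩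
  refine (Set.countable_range (Finsupp.mapRange ((↑) : ↥(insert 0 F) → β) rfl)).mono ?_
  rw [Finsupp.range_mapRange, Subtype.range_coe]
  exact fun φ hφ i => Set.mem_insert_of_mem 0 (hφ i)

end Countability

section Idempotents

lemma finite_setOf_isIdempotentElem (R : Type*) [CommRing R] [IsArtinianRing R] :
    {e : R | IsIdempotentElem e}.Finite := by
  have : Finite (TopologicalSpace.Clopens (PrimeSpectrum R)) :=
    .of_injective _ SetLike.coe_injective
  exact Set.finite_coe_iff.mp <|
    .of_equiv _ (PrimeSpectrum.isIdempotentElemEquivClopens (R := R)).symm.toEquiv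

variable {K E : Type*} [Field K] [CommRing E] [Algebra K E]

/-- The largest ideal on which the linear map `l` vanishes, that is, the radical of the pairing
`(e, g) ↦ l (e * g)`. -/
def pairingRadical {W : Type*} [AddCommGroup W] [Module K W] (l : E →ₗ[K] W) : Ideal E where
  carrier := {e | ∀ g, l (e * g) = 0}
  add_mem' ha hb g := by rw [add_mul, map_add, ha, hb, add_zero]
  zero_mem' g := by rw [zero_mul, map_zero]
  smul_mem' c e he g := by rw [smul_eq_mul, mul_comm c, mul_assoc, he]

variable {V W : Type*} [AddCommGroup V] [Module K V] [Module.Finite K V] [AddCommGroup W]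
  [Module K W]

lemma finite_quotient_pairingRadical {l : E →ₗ[K] W} {ev : E →ₗ[K] V}
    (hl : ∀ e g, ev e = 0 → l (e * g) = 0) : Module.Finite K (E ⧸ pairingRadical l) := by
  have ker_le : LinearMap.ker ev ≤ (pairingRadical l).restrictScalars K := fun e he g => hl e g he
  have : Module.Finite K (E ⧸ LinearMap.ker ev) := .equiv ev.quotKerEquivRange.symm
  have : Module.Finite K (E ⧸ (pairingRadical l).restrictScalars K) :=
    .of_surjective _ (Submodule.factor_surjective ker_le)
  exact .equiv (Submodule.Quotient.restrictScalarsEquiv K (pairingRadical l))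

lemma finite_image_setOf_isIdempotentElem {l : E →ₗ[K] W} {ev : E →ₗ[K] V}
    (hl : ∀ e g, ev e = 0 → l (e * g) = 0) : (l '' {e | IsIdempotentElem e}).Finite := by
  let J := pairingRadical l
  have : Module.Finite K (E ⧸ J) := finite_quotient_pairingRadical hl
  have : IsArtinianRing (E ⧸ J) := .of_finite K (E ⧸ J)
  have eq_of_mk_eq {e e' : E} (h : Ideal.Quotient.mk J e = Ideal.Quotient.mk J e') :
      l e = l e' := by
    have : l ((e - e') * 1) = 0 := Ideal.Quotient.eq.mp h 1
    rwa [mul_one, map_sub, sub_eq_zero] at this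
  refine ((finite_setOf_isIdempotentElem (E ⧸ J)).image fun q => l q.out).subset ?_
  rintro _ ⟨e, he, rfl⟩
  exact ⟨Ideal.Quotient.mk J e, he.map _, eq_of_mk_eq (Ideal.Quotient.mk_out _)⟩

open scoped IsMulCommutative in
/-- The value of `e * g` at `f` depends on `e` only through its values at the left tensor factors
of `Δ f`, so the pairing `(e, g) ↦ (e * g) f` on the algebra generated by `T` has finite rank. -/
lemma finite_image_apply_of_commute_of_isIdempotentElem {k K C : Type*} [CommRing k] [Field K]
    [Algebra k K] [AddCommGroup C] [Module k C] [Coalgebra k C] {T : Set (WithConv (C →ₗ[k] K))}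
    (hcomm : ∀ e ∈ T, ∀ e' ∈ T, Commute e e') (hidem : ∀ e ∈ T, IsIdempotentElem e) (f : C) :
    ((fun e => e.ofConv f) '' T).Finite := by
  have := Algebra.isMulCommutative_adjoin K hcomm
  let r := Coalgebra.Repr.arbitrary k f
  let evalAt (c : C) : Algebra.adjoin K T →ₗ[K] K :=
    { toFun := fun e => e.1.ofConv c
      map_add' := fun _ _ => rfl
      map_smul' := fun _ _ => rfl }
  let evalLeft : Algebra.adjoin K T →ₗ[K] (r.index → K) := LinearMap.pi fun i => evalAt (r.left i)
  have evalAt_mul_eq_zero (e g : Algebra.adjoin K T) (he : evalLeft e = 0) :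
      evalAt f (e * g) = 0 := by
    refine (r.convMul_apply e.1 g.1).trans (Finset.sum_eq_zero fun i hi => ?_)
    have : e.1.ofConv (r.left i) = 0 := congrFun he ⟨i, hi⟩
    rw [this, zero_mul]
  refine (finite_image_setOf_isIdempotentElem evalAt_mul_eq_zero).subset ?_
  rintro _ ⟨e, he, rfl⟩
  exact ⟨⟨e, Algebra.subset_adjoin he⟩, Subtype.ext (hidem e he), rfl⟩

end Idempotents

lemma toConv_mul_toConv_eq_toConv_comp {k A B R : Type*} [CommSemiring k] [Semiring A]
    [Bialgebra k A] [CommSemiring B] [Algebra k B] [CommSemiring R] [Algebra k R]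
    {μ : R →ₗ[k] B} {α β : A →ₗ[k] B} {p q : WithConv (A →ₐ[k] R)}
    (h : ∀ f g, α f * β g = μ (p.ofConv f * q.ofConv g)) :
    toConv α * toConv β = toConv (μ ∘ₗ (p * q).ofConv.toLinearMap) := by
  ext f
  let r := Coalgebra.Repr.arbitrary k f
  calc (toConv α * toConv β).ofConv f
  _ = ∑ i ∈ r.index, α (r.left i) * β (r.right i) := r.convMul_apply _ _
  _ = μ (∑ i ∈ r.index, p.ofConv (r.left i) * q.ofConv (r.right i)) := by simp only [h, map_sum]
  _ = μ ((p * q).ofConv f) := congrArg μ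
    (r.convMul_apply (toConv p.ofConv.toLinearMap) (toConv q.ofConv.toLinearMap)).symm

lemma isIdempotentElem_toConv_coeff {K Λ : Type*} [CommSemiring K] (χ : Λ) :
    IsIdempotentElem (toConv (Finsupp.lapply χ ∘ₗ
      (AddMonoidAlgebra.coeffLinearEquiv K : AddMonoidAlgebra K Λ ≃ₗ[K] Λ →₀ K).toLinearMap)) := by
  classical
  apply WithConv.ext
  ext ψ
  by_cases h : ψ = χ <;> simp [LinearMap.convMul_def, h]

namespace AlgGrp

section Points

variable {k : Type} [Field k] {G : AlgGrp.{u} k} {H : AlgGrp.{v} k} {R R' : Type*}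
  [CommRing R] [Algebra k R] [CommRing R'] [Algebra k R']

lemma Points.map_mul (f : R →ₐ[k] R') (g h : G.Points R) :
    Points.map f (g * h) = g.map f * h.map f :=
  WithConv.ext (AlgHom.comp_convMul_distrib f g h)

lemma Points.map_one (f : R →ₐ[k] R') : Points.map f (1 : G.Points R) = 1 :=
  WithConv.ext <| AlgHom.ext fun _ => f.commutes _

lemma Hom.onPoints_mul (φ : Hom G H) (g h : G.Points R) :
    φ.onPoints (g * h) = φ.onPoints g * φ.onPoints h :=
  WithConv.ext (AlgHom.convMul_comp_bialgHom_distrib g h φ)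

lemma Hom.onPoints_one (φ : Hom G H) : φ.onPoints (1 : G.Points R) = 1 :=
  WithConv.ext <| AlgHom.ext fun f =>
    congrArg (algebraMap k R) (CoalgHomClass.counit_comp_apply φ f)

lemma Hom.onPoints_inv (φ : Hom G H) (g : G.Points R) :
    φ.onPoints g⁻¹ = (φ.onPoints g)⁻¹ :=
  eq_inv_of_mul_eq_one_left (by rw [← φ.onPoints_mul, inv_mul_cancel, φ.onPoints_one])

lemma Hom.onPoints_map (φ : Hom G H) (f : R →ₐ[k] R') (g : G.Points R) :
    φ.onPoints (g.map f) = (φ.onPoints g).map f := rfl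

lemma Hom.commute_onPoints {g h : G.Points R} (φ : Hom G H) (hc : Commute g h) :
    Commute (φ.onPoints g) (φ.onPoints h) :=
  (φ.onPoints_mul g h).symm.trans ((congrArg φ.onPoints hc.eq).trans (φ.onPoints_mul h g))

end Points

section CommutingHoms

variable {k : Type} [Field k]

/-- The universal point `T × T → T` of the first factor. -/
def fstPoint (T : AlgGrp.{u} k) : T.Points (T.coord ⊗[k] T.coord) :=
  toConv Algebra.TensorProduct.includeLeft

/-- The universal point `T × T → T` of the second factor. -/
def sndPoint (T : AlgGrp.{u} k) : T.Points (T.coord ⊗[k] T.coord) :=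
  toConv Algebra.TensorProduct.includeRight

variable {T : AlgGrp.{u} k} {G : AlgGrp.{v} k}

/-- Homomorphisms `h, h' : T → G` commute if `h(t)` and `h'(t')` commute for all points `t, t'` of
`T`. By the Yoneda lemma it is enough that this holds for the two universal points of `T × T`. -/
def Hom.Commutes (h h' : Hom T G) : Prop :=
  Commute (h.onPoints T.fstPoint) (h'.onPoints T.sndPoint)

lemma Hom.commutes_self [Coalgebra.IsCocomm k T.coord] (h : Hom T G) : h.Commutes h :=
  h.commute_onPoints (mul_comm T.fstPoint T.sndPoint)

variable {K : Type*} [Field K] [Algebra k K]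

/-- The pushforward `h_* α` of a linear functional. -/
def Hom.pushforward (h : Hom T G) (α : WithConv (T.coord →ₗ[k] K)) : WithConv (G.coord →ₗ[k] K) :=
  toConv (α.ofConv ∘ₗ (h : G.coord →ₗ[k] T.coord))

lemma Hom.pushforward_mul (h : Hom T G) (α β : WithConv (T.coord →ₗ[k] K)) :
    h.pushforward (α * β) = h.pushforward α * h.pushforward β :=
  WithConv.ext (LinearMap.convMul_comp_coalgHom_distrib α β (h : G.coord →ₗc[k] T.coord))

lemma Hom.Commutes.commute_pushforward {h h' : Hom T G} (hc : h.Commutes h')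
    (α β : WithConv (T.coord →ₗ[k] K)) : Commute (h.pushforward α) (h'.pushforward β) := by
  let μ := LinearMap.mul' k K ∘ₗ TensorProduct.map α.ofConv β.ofConv
  calc h.pushforward α * h'.pushforward β
  _ = toConv (μ ∘ₗ (h.onPoints T.fstPoint * h'.onPoints T.sndPoint).ofConv.toLinearMap) :=
    toConv_mul_toConv_eq_toConv_comp fun f g => by simp [μ, Hom.onPoints, fstPoint, sndPoint]
  _ = toConv (μ ∘ₗ (h'.onPoints T.sndPoint * h.onPoints T.fstPoint).ofConv.toLinearMap) :=
    congrArg (fun p => toConv (μ ∘ₗ (ofConv p).toLinearMap)) hc.eq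
  _ = h'.pushforward β * h.pushforward α := .symm <|
    toConv_mul_toConv_eq_toConv_comp fun f g => by
      simp [μ, Hom.onPoints, fstPoint, sndPoint, mul_comm]

variable {Λ : Type*} [Countable Λ] {e : T.coord →ₗ[k] Λ →₀ K}

lemma countable_image_apply_of_pairwise_commutes (he : Function.Injective e)
    (hidem : ∀ χ, IsIdempotentElem (toConv (Finsupp.lapply χ ∘ₗ e))) {S : Set (Hom T G)}
    (hS : ∀ h ∈ S, ∀ h' ∈ S, h.Commutes h') (f : G.coord) :
    ((fun h : Hom T G => h f) '' S).Countable := by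
  let weights : Set (WithConv (G.coord →ₗ[k] K)) :=
    {w | ∃ h ∈ S, ∃ χ, w = Hom.pushforward h (toConv (Finsupp.lapply χ ∘ₗ e))}
  have finite_weights : ((fun w => w.ofConv f) '' weights).Finite := by
    apply finite_image_apply_of_commute_of_isIdempotentElem
    · rintro _ ⟨h, hh, χ, rfl⟩ _ ⟨h', hh', χ', rfl⟩
      exact (hS h hh h' hh').commute_pushforward _ _
    · rintro _ ⟨h, -, χ, rfl⟩
      exact (h.pushforward_mul _ _).symm.trans (congrArg h.pushforward (hidem χ).eq)
  refine ((countable_setOf_finsupp_forall_mem finite_weights.countable).preimage_of_injOn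
    he.injOn).mono ?_
  rintro _ ⟨h, hh, rfl⟩ χ
  exact ⟨_, ⟨h, hh, χ, rfl⟩, rfl⟩

lemma Hom.countable_of_forall_countable_image_apply {S : Set (Hom T G)}
    (hS : ∀ f, ((fun h : Hom T G => h f) '' S).Countable) : S.Countable := by
  obtain ⟨s, hs⟩ := (Algebra.FiniteType.out : (⊤ : Subalgebra k G.coord).FG)
  refine ((Set.countable_univ_pi fun f : s => hS f).preimage_of_injOn
    (f := fun (h : Hom T G) (f : s) => h f) ?_).mono ?_
  · intro h _ h' _ eq_on_s
    have : (h : G.coord →ₐ[k] T.coord) = h' :=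
      AlgHom.ext_of_adjoin_eq_top hs fun f hf => congrFun eq_on_s ⟨f, hf⟩
    exact DFunLike.ext _ _ (AlgHom.congr_fun this)
  · exact fun h hh f _ => ⟨h, hh, rfl⟩

theorem countable_of_pairwise_commutes (he : Function.Injective e)
    (hidem : ∀ χ, IsIdempotentElem (toConv (Finsupp.lapply χ ∘ₗ e))) {S : Set (Hom T G)}
    (hS : ∀ h ∈ S, ∀ h' ∈ S, h.Commutes h') : S.Countable :=
  Hom.countable_of_forall_countable_image_apply
    (countable_image_apply_of_pairwise_commutes he hidem hS)

end CommutingHoms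

end AlgGrp

namespace DeligneRing

lemma comul_a : Coalgebra.comul (R := ℝ) a = a ⊗ₜ a - b ⊗ₜ b := by
  change comulHom a = _
  simp [comulHom]

lemma comul_b : Coalgebra.comul (R := ℝ) b = a ⊗ₜ b + b ⊗ₜ a := by
  change comulHom b = _
  simp [comulHom]

instance : Coalgebra.IsCocomm ℝ DeligneRing where
  comm_comp_comul := by
    have : (Algebra.TensorProduct.comm ℝ DeligneRing DeligneRing).toAlgHom.comp
        (Bialgebra.comulAlgHom ℝ DeligneRing) = Bialgebra.comulAlgHom ℝ DeligneRing := by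
      apply algHom_ext <;> simp [comul_a, comul_b, add_comm]
    exact congrArg AlgHom.toLinearMap this

section Multiplication

variable {B : Type*} [CommRing B] [Algebra ℝ B] (p q : WithConv (DeligneRing →ₐ[ℝ] B))

lemma convMul_apply_a : (p * q).ofConv a = p.ofConv a * q.ofConv a - p.ofConv b * q.ofConv b := by
  simp [AlgHom.convMul_def, comul_a]

lemma convMul_apply_b : (p * q).ofConv b = p.ofConv a * q.ofConv b + p.ofConv b * q.ofConv a := by
  simp [AlgHom.convMul_def, comul_b]

end Multiplication

section Splitting

lemma I_div_two_mul_self : Complex.I / 2 * (Complex.I / 2) = -(1 / 4) := by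
  linear_combination (1 / 4 : ℂ) * Complex.I_sq

variable {B B' : Type*} [CommRing B] [Algebra ℂ B] [Algebra ℝ B]

/-- The isomorphism `𝔾ₘ × 𝔾ₘ ≅ 𝕊_ℂ`, on points with values in a `ℂ`-algebra `B`: the point of `𝕊`
at which `a + b i = z` and `a - b i = w`. -/
noncomputable def splitPoint (z w : Bˣ) : WithConv (DeligneRing →ₐ[ℝ] B) :=
  toConv <| lift ((1 / 2 : ℂ) • (z + w : B)) ((Complex.I / 2) • (w - z : B)) <| by
    have norm_eq : ((1 / 2 : ℂ) • (z + w : B)) ^ 2 + ((Complex.I / 2) • (w - z : B)) ^ 2 =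
        z * w := by
      simp only [sq, smul_mul_smul_comm, I_div_two_mul_self, mul_add, add_mul, mul_sub, sub_mul,
        mul_comm (w : B) z]
      module
    exact norm_eq ▸ z.isUnit.mul w.isUnit

@[simp]
lemma splitPoint_a (z w : Bˣ) : (splitPoint z w).ofConv a = (1 / 2 : ℂ) • (z + w : B) := by
  simp [splitPoint]

@[simp]
lemma splitPoint_b (z w : Bˣ) : (splitPoint z w).ofConv b = (Complex.I / 2) • (w - z : B) := by
  simp [splitPoint]

lemma splitPoint_mul (z w z' w' : Bˣ) :
    splitPoint (z * z') (w * w') = splitPoint z w * splitPoint z' w' := by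
  apply WithConv.ext
  apply algHom_ext
  · simp only [convMul_apply_a, splitPoint_a, splitPoint_b, Units.val_mul, smul_mul_smul_comm,
      I_div_two_mul_self, mul_add, add_mul, mul_sub, sub_mul]
    module
  · simp only [convMul_apply_b, splitPoint_a, splitPoint_b, Units.val_mul, smul_mul_smul_comm,
      mul_add, add_mul, mul_sub, sub_mul]
    module

lemma exists_splitPoint_eq (p : WithConv (DeligneRing →ₐ[ℝ] B)) :
    ∃ z w, splitPoint z w = p := by
  have norm_eq : (p.ofConv a + Complex.I • p.ofConv b) * (p.ofConv a - Complex.I • p.ofConv b) =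
      p.ofConv (a ^ 2 + b ^ 2) := by
    rw [← sq_sub_sq, smul_pow, Complex.I_sq, neg_one_smul, sub_neg_eq_add, map_add, map_pow,
      map_pow]
  have hu := norm_eq ▸ isUnit_norm.map p.ofConv
  refine ⟨(isUnit_of_mul_isUnit_left hu).unit, (isUnit_of_mul_isUnit_right hu).unit, ?_⟩
  apply WithConv.ext
  apply algHom_ext
  · simp only [splitPoint_a, IsUnit.unit_spec]
    module
  · simp only [splitPoint_b, IsUnit.unit_spec]
    calc (Complex.I / 2) • (p.ofConv a - Complex.I • p.ofConv b -
          (p.ofConv a + Complex.I • p.ofConv b))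
    _ = (-Complex.I ^ 2) • p.ofConv b := by module
    _ = p.ofConv b := by rw [Complex.I_sq, neg_neg, one_smul]

variable [IsScalarTower ℝ ℂ B] [CommRing B'] [Algebra ℂ B'] [Algebra ℝ B'] [IsScalarTower ℝ ℂ B']

lemma comp_splitPoint (f : B →ₐ[ℂ] B') (z w : Bˣ) :
    (f.restrictScalars ℝ).comp (splitPoint z w).ofConv =
      (splitPoint (z.map f) (w.map f)).ofConv := by
  apply algHom_ext <;> simp

end Splitting

section Expansion

/-- The coordinate ring `ℂ[z, z⁻¹, z̄, z̄⁻¹]` of the torus `𝕊_ℂ ≅ 𝔾ₘ × 𝔾ₘ`, as the group algebra of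
its character group: `(m, n)` stands for the character `z ^ m * z̄ ^ n`. -/
abbrev SplitRing : Type := AddMonoidAlgebra ℂ (ℤ × ℤ)

/-- A character of `𝕊_ℂ`, as an invertible function. -/
noncomputable def character : Multiplicative (ℤ × ℤ) →* SplitRingˣ :=
  (AddMonoidAlgebra.of ℂ (ℤ × ℤ)).toHomUnits

/-- The expansion of functions on the Deligne torus in the characters `z ^ m * z̄ ^ n`. -/
noncomputable def expand : DeligneRing →ₐ[ℝ] SplitRing :=
  (splitPoint (character (.ofAdd (1, 0))) (character (.ofAdd (0, 1)))).ofConv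

lemma exists_comp_expand_eq {B : Type*} [CommRing B] [Algebra ℂ B] [Algebra ℝ B]
    [IsScalarTower ℝ ℂ B] (p : DeligneRing →ₐ[ℝ] B) :
    ∃ σ : SplitRing →ₐ[ℂ] B, (σ.restrictScalars ℝ).comp expand = p := by
  obtain ⟨z, w, h⟩ := exists_splitPoint_eq (toConv p)
  let evalChar : Multiplicative (ℤ × ℤ) →* Bˣ :=
    ((zpowersHom Bˣ z).coprod (zpowersHom Bˣ w)).comp
      (MulEquiv.prodMultiplicative ℤ ℤ : Multiplicative (ℤ × ℤ) →* _)
  refine ⟨AddMonoidAlgebra.lift ℂ B (ℤ × ℤ) ((Units.coeHom B).comp evalChar), ?_⟩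
  rw [expand, comp_splitPoint]
  refine .trans ?_ (congrArg ofConv h)
  congr <;> ext <;> simp [evalChar, character]

lemma expand_injective : Function.Injective expand := by
  let incl : DeligneRing →ₐ[ℝ] ℂ ⊗[ℝ] DeligneRing := Algebra.TensorProduct.includeRight
  obtain ⟨σ, hσ⟩ := exists_comp_expand_eq incl
  have comp_eq : σ ∘ expand = incl := congrArg DFunLike.coe hσ
  refine .of_comp (f := σ) ?_
  rw [comp_eq]
  exact Algebra.TensorProduct.includeRight_injective (algebraMap ℝ ℂ).injective

lemma algHom_convMul_comp_expand {B : Type*} [CommRing B] [Algebra ℂ B] [Algebra ℝ B]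
    [IsScalarTower ℝ ℂ B] (p q : WithConv (SplitRing →ₐ[ℂ] B)) :
    toConv (((p * q).ofConv.restrictScalars ℝ).comp expand) =
      toConv ((p.ofConv.restrictScalars ℝ).comp expand) *
        toConv ((q.ofConv.restrictScalars ℝ).comp expand) := by
  have map_character (χ) : (character χ).map ((p * q).ofConv : SplitRing →* B) =
      (character χ).map (p.ofConv : SplitRing →* B) *
        (character χ).map (q.ofConv : SplitRing →* B) := by
    ext
    simp [character, AlgHom.convMul_def]
  simp only [expand, comp_splitPoint]
  refine .trans ?_ (splitPoint_mul _ _ _ _)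
  exact congrArg₂ splitPoint (map_character _) (map_character _)

lemma linearMap_convMul_comp_expand (α β : WithConv (SplitRing →ₗ[ℂ] ℂ)) :
    toConv ((α * β).ofConv.restrictScalars ℝ ∘ₗ expand.toLinearMap) =
      toConv (α.ofConv.restrictScalars ℝ ∘ₗ expand.toLinearMap) *
        toConv (β.ofConv.restrictScalars ℝ ∘ₗ expand.toLinearMap) := by
  let μ : SplitRing ⊗[ℂ] SplitRing →ₗ[ℂ] ℂ :=
    LinearMap.mul' ℂ ℂ ∘ₗ TensorProduct.map α.ofConv β.ofConv
  let p : WithConv (SplitRing →ₐ[ℂ] SplitRing ⊗[ℂ] SplitRing) :=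
    toConv Algebra.TensorProduct.includeLeft
  let q : WithConv (SplitRing →ₐ[ℂ] SplitRing ⊗[ℂ] SplitRing) :=
    toConv Algebra.TensorProduct.includeRight
  have convMul_eq : α * β = toConv (μ ∘ₗ (p * q).ofConv.toLinearMap) :=
    toConv_mul_toConv_eq_toConv_comp fun f g => by simp [μ, p, q]
  rw [toConv_mul_toConv_eq_toConv_comp (μ := μ.restrictScalars ℝ)
    (p := toConv ((p.ofConv.restrictScalars ℝ).comp expand))
    (q := toConv ((q.ofConv.restrictScalars ℝ).comp expand))
    fun f g => by simp [μ, p, q], ← algHom_convMul_comp_expand, convMul_eq]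
  rfl

/-- The coefficients of a function on the Deligne torus in the characters `z ^ m * z̄ ^ n`. -/
noncomputable def weightCoeffs : DeligneRing →ₗ[ℝ] ℤ × ℤ →₀ ℂ :=
  (AddMonoidAlgebra.coeffLinearEquiv ℝ).toLinearMap ∘ₗ expand.toLinearMap

lemma weightCoeffs_injective : Function.Injective weightCoeffs :=
  AddMonoidAlgebra.coeff_injective.comp expand_injective

lemma isIdempotentElem_toConv_weightCoeff (χ : ℤ × ℤ) :
    IsIdempotentElem (toConv (Finsupp.lapply χ ∘ₗ weightCoeffs)) := by
  let coeff : WithConv (SplitRing →ₗ[ℂ] ℂ) :=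
    toConv (Finsupp.lapply χ ∘ₗ (AddMonoidAlgebra.coeffLinearEquiv ℂ).toLinearMap)
  have weightCoeff_eq : Finsupp.lapply χ ∘ₗ weightCoeffs =
      coeff.ofConv.restrictScalars ℝ ∘ₗ expand.toLinearMap := LinearMap.ext fun _ => rfl
  have coeff_mul_self : coeff * coeff = coeff := isIdempotentElem_toConv_coeff χ
  rw [weightCoeff_eq, IsIdempotentElem, ← linearMap_convMul_comp_expand, coeff_mul_self]

end Expansion

end DeligneRing

instance : Coalgebra.IsCocomm ℝ deligneTorus.coord :=
  inferInstanceAs (Coalgebra.IsCocomm ℝ DeligneRing)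

lemma deligneTorus_countable_of_pairwise_commutes {G : AlgGrp.{u} ℝ}
    {S : Set (Hom deligneTorus G)} (hS : ∀ h ∈ S, ∀ h' ∈ S, h.Commutes h') : S.Countable :=
  countable_of_pairwise_commutes DeligneRing.weightCoeffs_injective
    DeligneRing.isIdempotentElem_toConv_weightCoeff hS

namespace AlgGrp

section Subgroups

variable {k : Type} [Field k] {G : AlgGrp.{u} k} {H : AlgGrp.{v} k} {R : Type*}
  [CommRing R] [Algebra k R]

lemma Hom.IsClosedImmersion.exists_onPoints_eq {ι : Hom H G} (hι : ι.IsClosedImmersion)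
    {g : G.Points R} (hg : ∀ f, ι f = 0 → g.ofConv f = 0) :
    ∃ g' : H.Points R, ι.onPoints g' = g :=
  ⟨toConv (AlgHom.liftOfSurjective (ι : G.coord →ₐ[k] H.coord) hι g.ofConv hg),
    WithConv.ext (AlgHom.liftOfSurjective_comp (ι : G.coord →ₐ[k] H.coord) hι g.ofConv hg)⟩

lemma Hom.onPoints_eq_of_eqOn {Q : AlgGrp k} {φ : Hom H Q} {ι : Hom H G} {s : Set G.coord}
    (hs : Set.range φ ⊆ Algebra.adjoin k (ι '' s)) {g g' : H.Points R}
    (eq_on : Set.EqOn (ι.onPoints g).ofConv (ι.onPoints g').ofConv s) :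
    φ.onPoints g = φ.onPoints g' := by
  have adjoin_le : Algebra.adjoin k (ι '' s) ≤ AlgHom.equalizer g.ofConv g'.ofConv := by
    rw [Algebra.adjoin_le_iff]
    rintro _ ⟨f, hf, rfl⟩
    exact eq_on hf
  exact WithConv.ext (AlgHom.ext fun f => adjoin_le (hs ⟨f, rfl⟩))

end Subgroups

namespace AdjointQuotient

variable {k : Type} [Field k] {G : AlgGrp.{u} k} {R R' : Type} [CommRing R] [Algebra k R]
  [CommRing R'] [Algebra k R'] (P : AdjointQuotient G)

lemma commute_map_of_onPoints_eq_one {z : G.Points R} (hz : P.proj.onPoints z = 1)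
    (f : R →ₐ[k] R') (g : G.Points R') : Commute (z.map f) g := by
  let up : R →ₐ[k] ULift.{u} R := (ULift.algEquiv (R := k)).symm.toAlgHom
  let down : ULift.{u} R →ₐ[k] R := (ULift.algEquiv (R := k)).toAlgHom
  let up' : R' →ₐ[k] ULift.{u} R' := (ULift.algEquiv (R := k)).symm.toAlgHom
  let down' : ULift.{u} R' →ₐ[k] R' := (ULift.algEquiv (R := k)).toAlgHom
  have onPoints_up : P.proj.onPoints (z.map up) = 1 := by
    rw [Hom.onPoints_map, hz, Points.map_one]
  have commute_up : (z.map f).map up' * g.map up' = g.map up' * (z.map f).map up' :=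
    (P.ker_eq_centre _ _).mp onPoints_up _ (up'.comp (f.comp down)) (g.map up')
  have := congrArg (Points.map down') commute_up
  rwa [Points.map_mul, Points.map_mul] at this

lemma commute_map_of_onPoints_eq {g g' : G.Points R} (h : P.proj.onPoints g = P.proj.onPoints g')
    {f₁ f₂ : R →ₐ[k] R'} (hc : Commute (g.map f₁) (g.map f₂)) :
    Commute (g.map f₁) (g'.map f₂) := by
  have onPoints_quot : P.proj.onPoints (g⁻¹ * g') = 1 := by
    rw [Hom.onPoints_mul, Hom.onPoints_inv, h, inv_mul_cancel]
  have map_eq : g'.map f₂ = g.map f₂ * (g⁻¹ * g').map f₂ := by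
    rw [← Points.map_mul, mul_inv_cancel_left]
  rw [map_eq]
  exact hc.mul_right (P.commute_map_of_onPoints_eq_one onPoints_quot f₂ _).symm

end AdjointQuotient

section BaseChange

variable {k K : Type} [Field k] [Field K] [Algebra k K] {G : AlgGrp.{u} k} {R : Type*}
  [CommRing R] [Algebra k R] [Algebra K R] [IsScalarTower k K R]

/-- The identification `G_K(R) = G(R)` for a `K`-algebra `R`. -/
def Points.descend (p : (G.baseChange K).Points R) : G.Points R :=
  let p' : K ⊗[k] G.coord →ₐ[K] R := p.ofConv
  toConv ((p'.restrictScalars k).comp Algebra.TensorProduct.includeRight)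

lemma Points.descend_injective :
    Function.Injective (descend : (G.baseChange K).Points R → G.Points R) := fun _ _ h =>
  WithConv.ext (Algebra.TensorProduct.ext_ring (R := k) (A := G.coord) (congrArg ofConv h))

lemma Points.descend_mul (p q : (G.baseChange K).Points R) :
    Points.descend (p * q) = p.descend * q.descend := by
  apply WithConv.ext
  ext f
  let r := Coalgebra.Repr.arbitrary k f
  have comul_eq : Coalgebra.comul (R := K) (1 ⊗ₜ[k] f : K ⊗[k] G.coord) =
      ∑ i ∈ r.index, (1 ⊗ₜ[k] r.left i) ⊗ₜ[K] (1 ⊗ₜ[k] r.right i) := by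
    rw [TensorProduct.comul_tmul, ← r.eq]
    simp [TensorProduct.tmul_sum]
  let p' : K ⊗[k] G.coord →ₐ[K] R := p.ofConv
  let q' : K ⊗[k] G.coord →ₐ[K] R := q.ofConv
  calc (p * q).descend.ofConv f
  _ = ∑ i ∈ r.index, p' (1 ⊗ₜ r.left i) * q' (1 ⊗ₜ r.right i) := by
    refine (congrArg (fun t => LinearMap.mul' K R (TensorProduct.map p'.toLinearMap
      q'.toLinearMap t)) comul_eq).trans ?_
    simp
  _ = (p.descend * q.descend).ofConv f :=
    (r.convMul_apply (toConv p.descend.ofConv.toLinearMap)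
      (toConv q.descend.ofConv.toLinearMap)).symm

lemma Points.commute_descend_iff {p q : (G.baseChange K).Points R} :
    Commute p.descend q.descend ↔ Commute p q := by
  rw [Commute, SemiconjBy, ← descend_mul, ← descend_mul, descend_injective.eq_iff]
  rfl

end BaseChange

end AlgGrp

namespace DeligneHom

variable {G : AlgGrp.{u} ℚ} {H : AlgGrp.{v} ℚ}

/-- A homomorphism `𝕊 → G_ℝ`, read as a point of `G` with values in `O(𝕊)`. -/
noncomputable def toPoint (h : DeligneHom G) : G.Points DeligneRing :=
  let h' : (G.baseChange ℝ).coord →ₐc[ℝ] DeligneRing := h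
  Points.descend (toConv (h' : (G.baseChange ℝ).coord →ₐ[ℝ] DeligneRing))

lemma toPoint_injective : Function.Injective (toPoint (G := G)) := fun _ _ h =>
  DFunLike.ext _ _ (AlgHom.congr_fun (congrArg ofConv (Points.descend_injective h)))

lemma push_andThen {K : AlgGrp ℚ} (h : DeligneHom G) (φ : Hom G H) (ψ : Hom H K) :
    h.push (φ.andThen ψ) = (h.push φ).push ψ :=
  toPoint_injective rfl

lemma onPoints_toPoint (h : DeligneHom G) (φ : Hom G H) :
    φ.onPoints h.toPoint = (h.push φ).toPoint := rfl

/-- The first inclusion `O(𝕊) → O(𝕊 × 𝕊)`, over `ℚ`. -/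
noncomputable def inclFst : DeligneRing →ₐ[ℚ] DeligneRing ⊗[ℝ] DeligneRing :=
  AlgHom.restrictScalars ℚ (Algebra.TensorProduct.includeLeft (R := ℝ) (S := ℝ))

/-- The second inclusion `O(𝕊) → O(𝕊 × 𝕊)`, over `ℚ`. -/
noncomputable def inclSnd : DeligneRing →ₐ[ℚ] DeligneRing ⊗[ℝ] DeligneRing :=
  AlgHom.restrictScalars ℚ (Algebra.TensorProduct.includeRight (R := ℝ))

lemma commutes_iff {h h' : DeligneHom G} :
    Hom.Commutes h h' ↔ Commute (h.toPoint.map inclFst) (h'.toPoint.map inclSnd) := by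
  let p : (G.baseChange ℝ).Points (DeligneRing ⊗[ℝ] DeligneRing) :=
    Hom.onPoints h deligneTorus.fstPoint
  let q : (G.baseChange ℝ).Points (DeligneRing ⊗[ℝ] DeligneRing) :=
    Hom.onPoints h' deligneTorus.sndPoint
  exact (Points.commute_descend_iff (p := p) (q := q)).symm

lemma push_commutes_of_eqOn {ι : Hom H G} (hι : ι.IsClosedImmersion) (P : AdjointQuotient H)
    (y : DeligneHom H) {x : DeligneHom G}
    (hker : ∀ f, ι f = 0 → x.toPoint.ofConv f = 0)
    {s : Set G.coord} (hs : Set.range P.proj ⊆ Algebra.adjoin ℚ (ι '' s))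
    (eq_on : Set.EqOn (y.push ι).toPoint.ofConv x.toPoint.ofConv s) :
    Hom.Commutes (y.push ι) x := by
  obtain ⟨y', hy'⟩ := hι.exists_onPoints_eq hker
  rw [← onPoints_toPoint, ← hy'] at eq_on
  have proj_eq : P.proj.onPoints y.toPoint = P.proj.onPoints y' := Hom.onPoints_eq_of_eqOn hs eq_on
  have commute_self : Commute (y.toPoint.map inclFst) (y.toPoint.map inclSnd) :=
    commutes_iff.mp (Hom.commutes_self y)
  have commute_y : Commute (y.toPoint.map inclFst) (y'.map inclSnd) :=
    P.commute_map_of_onPoints_eq proj_eq commute_self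
  rw [commutes_iff, ← hy', ← onPoints_toPoint, ← Hom.onPoints_map, ← Hom.onPoints_map]
  exact ι.commute_onPoints commute_y

end DeligneHom

/-- The stratum of homomorphisms `x' : 𝕊 → G_ℝ` that factor through the closed subgroup of `G`
defined by the ideal `I`, such that every function on the adjoint group of this subgroup is a
polynomial in the functions `s`, `(s, t) ∈ l`, and `s ∘ x' = t ∘ x` for all `(s, t) ∈ l`. Countably
many strata with finite `l` cover the hybrid Hecke orbit of `x`. -/
def orbitStratum {G : AlgGrp.{u} ℚ} {M : AlgGrp.{v} ℚ} (x : DeligneHom M) (I : Ideal G.coord)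
    (l : Set (G.coord × M.coord)) : Set (DeligneHom G) :=
  {x' | (∃ (H : AlgGrp.{u} ℚ) (ι : Hom H G) (y : DeligneHom H) (P : AdjointQuotient H),
      ι.IsClosedImmersion ∧ y.push ι = x' ∧ RingHom.ker (ι : G.coord →ₐ[ℚ] H.coord) = I ∧
      Set.range P.proj ⊆ Algebra.adjoin ℚ (ι '' (Prod.fst '' l))) ∧
    ∀ p ∈ l, x'.toPoint.ofConv p.1 = x.toPoint.ofConv p.2}

section OrbitStratum

variable {G : AlgGrp.{u} ℚ} {M : AlgGrp.{v} ℚ} {x : DeligneHom M}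

lemma commutes_of_mem_orbitStratum {I : Ideal G.coord} {l : Set (G.coord × M.coord)}
    {x₁ x₂ : DeligneHom G} (h₁ : x₁ ∈ orbitStratum x I l) (h₂ : x₂ ∈ orbitStratum x I l) :
    Hom.Commutes x₁ x₂ := by
  obtain ⟨⟨H, ι, y, P, hι, rfl, hker, hP⟩, eq₁⟩ := h₁
  obtain ⟨⟨H₂, ι₂, y₂, -, -, rfl, hker₂, -⟩, eq₂⟩ := h₂
  have eq_zero (f) (hf : ι f = 0) : (y₂.push ι₂).toPoint.ofConv f = 0 := by
    have hf₂ : ι₂ f = 0 := hker₂.ge (hker.le hf)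
    exact (congrArg y₂.toPoint.ofConv hf₂).trans (map_zero _)
  refine DeligneHom.push_commutes_of_eqOn hι P y eq_zero hP ?_
  rintro _ ⟨p, hp, rfl⟩
  exact (eq₁ p hp).trans (eq₂ p hp).symm

lemma countable_orbitStratum (I : Ideal G.coord) (l : Set (G.coord × M.coord)) :
    (orbitStratum x I l).Countable :=
  deligneTorus_countable_of_pairwise_commutes fun _ h₁ _ h₂ => commutes_of_mem_orbitStratum h₁ h₂

lemma exists_mem_orbitStratum {H : AlgGrp.{u} ℚ} {ι : Hom H G} (hι : ι.IsClosedImmersion)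
    {y : DeligneHom H} {P : AdjointQuotient H} {φ : Hom M P.grp}
    (hφ : x.push φ = y.push P.proj) :
    ∃ (I : Ideal G.coord) (l : Set (G.coord × M.coord)),
      l.Finite ∧ y.push ι ∈ orbitStratum x I l := by
  obtain ⟨gens, hgens⟩ := (Algebra.FiniteType.out : (⊤ : Subalgebra ℚ P.grp.coord).FG)
  obtain ⟨lift, ι_lift⟩ := Function.Surjective.hasRightInverse hι
  let l := (fun e => (lift (P.proj e), φ e)) '' (gens : Set P.grp.coord)
  refine ⟨_, l, gens.finite_toSet.image _, ⟨H, ι, y, P, hι, rfl, rfl, ?_⟩, ?_⟩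
  · have image_eq : ι '' (Prod.fst '' l) =
        (P.proj : P.grp.coord →ₐ[ℚ] H.coord) '' (gens : Set P.grp.coord) := by
      simp only [l, Set.image_image, ι_lift.eq]
      rfl
    rw [image_eq, ← AlgHom.map_adjoin, hgens, Algebra.map_top]
    exact subset_rfl
  · rintro _ ⟨e, -, rfl⟩
    calc (y.push ι).toPoint.ofConv (lift (P.proj e))
    _ = y.toPoint.ofConv (P.proj e) := congrArg y.toPoint.ofConv (ι_lift (P.proj e))
    _ = x.toPoint.ofConv (φ e) :=
      (AlgHom.congr_fun (congrArg (fun z => (DeligneHom.toPoint z).ofConv) hφ) e).symm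

end OrbitStratum

end HybridHecke

theorem mainTheorem8_general (G : HybridHecke.AlgGrp.{u} ℚ) {M : HybridHecke.AlgGrp.{v} ℚ}
    (x : HybridHecke.DeligneHom M) :
    {x' : HybridHecke.DeligneHom G | ∃ (H : HybridHecke.AlgGrp.{u} ℚ)
      (ι : HybridHecke.AlgGrp.Hom H G) (y : HybridHecke.DeligneHom H)
      (P : HybridHecke.AlgGrp.AdjointQuotient H) (φ : HybridHecke.AlgGrp.Hom M P.grp),
      ι.IsClosedImmersion ∧ y.push ι = x' ∧ x.push φ = y.push P.proj}.Countable := by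
  have : Countable G.coord := HybridHecke.countable_of_finiteType ℚ G.coord
  have : Countable M.coord := HybridHecke.countable_of_finiteType ℚ M.coord
  have : IsNoetherianRing G.coord := Algebra.FiniteType.isNoetherianRing ℚ G.coord
  have : Countable (Ideal G.coord) :=
    HybridHecke.countable_submodule_of_isNoetherian G.coord G.coord
  have countable_strata : (⋃ (I : Ideal G.coord), ⋃ l ∈ {l : Set (G.coord × M.coord) | l.Finite},
      HybridHecke.orbitStratum x I l).Countable :=
    Set.countable_iUnion fun I => Set.Countable.ofPred_finite.biUnion fun l _ =>
      HybridHecke.countable_orbitStratum I l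
  refine countable_strata.mono ?_
  rintro _ ⟨H, ι, y, P, φ, hι, rfl, hφ⟩
  obtain ⟨I, l, hl, mem_stratum⟩ := HybridHecke.exists_mem_orbitStratum hι hφ
  exact Set.mem_iUnion.mpr ⟨I, Set.mem_biUnion hl mem_stratum⟩

theorem mainTheorem8 (D : HybridHecke.ShimuraDatum.{u}) (M : HybridHecke.ShimuraDatum.{v})
    (x : HybridHecke.DeligneHom M.G) (hx : x ∈ M.X) (hgen : HybridHecke.IsHodgeGeneric M x) :
    (HybridHecke.hybridHeckeOrbit D M x).Countable := by
  refine (mainTheorem8_general D.G x).mono ?_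
  rintro x' ⟨-, T, P, P', φ, hφ⟩
  exact ⟨T.datum.G, T.incl, T.point, P', P.proj.andThen φ, T.isSubdatum.isClosedImmersion,
    T.push_point, (x.push_andThen P.proj φ).trans hφ⟩
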